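/- Let $H$ be an infinite-dimensional complex Hilbert space and let $T$ be a bounded positive operator on $H$ (that is, $T=T^*$ and $\langle Tx,x\rangle\ge 0$ for all $x\in H$). Call a bounded operator $S$ from a nonzero Hilbert space $M$ to $H$ minimum attaining if there is a unit vector $x\in M$ with $\|Sx\|=m(S):=\inf\{\|Sy\| : y\in M,\ \|y\|=1\}$, and call $T$ absolutely minimum attaining if $T|_M\colon M\to H$ is minimum attaining for every nonzero closed subspace $M$ of $H$. Let $\sigma_{ess}(T)=\sigma(T)\setminus\sigma_d(T)$, where $\sigma_d(T)$ is the set of eigenvalues of $T$ of finite multiplicity that are isolated points of the spectrum $\sigma(T)$, and let $m_e(T)=\inf\{|\lambda| : \lambda\in\sigma_{ess}(T)\}$. Then $T$ is absolutely minimum attaining if and only if both of the following hold: 1. $\sigma_{ess}(T)$ consists of exactly one point; 2. the interval $(m_e(T),\|T\|]$ contains only finitely many eigenvalues of $T$. -/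

import Mathlib

open Set Filter Topology

noncomputable section

/-- The minimum modulus `m(T) = inf {‖T x‖ : ‖x‖ = 1}`. -/
def minimumModulus {E F : Type*} [NormedAddCommGroup E] [NormedSpace ℂ E]
    [NormedAddCommGroup F] [NormedSpace ℂ F] (T : E →L[ℂ] F) : ℝ :=
  sInf {r : ℝ | ∃ x : E, ‖x‖ = 1 ∧ r = ‖T x‖}

/-- `T` is minimum attaining if `‖T x‖ = m(T)` for some unit vector `x`. -/
def IsMinimumAttaining {E F : Type*} [NormedAddCommGroup E] [NormedSpace ℂ E]
    [NormedAddCommGroup F] [NormedSpace ℂ F] (T : E →L[ℂ] F) : Prop :=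
  ∃ x : E, ‖x‖ = 1 ∧ ‖T x‖ = minimumModulus T

/-- `T` is absolutely minimum attaining if its restriction to every closed subspace is minimum
attaining. The zero subspace has no unit vector and is left out. -/
def IsAbsolutelyMinimumAttaining {E F : Type*} [NormedAddCommGroup E] [NormedSpace ℂ E]
    [NormedAddCommGroup F] [NormedSpace ℂ F] (T : E →L[ℂ] F) : Prop :=
  ∀ M : Submodule ℂ E, IsClosed (M : Set E) → M ≠ ⊥ → IsMinimumAttaining (T.comp M.subtypeL)

/-- The discrete spectrum of a self-adjoint operator: the eigenvalues of finite multiplicity that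
are isolated points of the spectrum. -/
def discreteSpectrum {H : Type*} [NormedAddCommGroup H] [InnerProductSpace ℂ H]
    (T : H →L[ℂ] H) : Set ℂ :=
  {z : ℂ | Module.End.HasEigenvalue (T : H →ₗ[ℂ] H) z ∧
    FiniteDimensional ℂ (Module.End.eigenspace (T : H →ₗ[ℂ] H) z) ∧
    ¬ AccPt z (𝓟 (spectrum ℂ T))}

/-- The essential spectrum of a self-adjoint operator: the complement of the discrete spectrum
in the spectrum. -/
def essentialSpectrum {H : Type*} [NormedAddCommGroup H] [InnerProductSpace ℂ H]
    (T : H →L[ℂ] H) : Set ℂ :=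
  spectrum ℂ T \ discreteSpectrum T

/-- The essential minimum modulus `m_e(T) = inf {|z| : z ∈ σ_ess(T)}` of a self-adjoint
operator. -/
def essentialMinimumModulus {H : Type*} [NormedAddCommGroup H] [InnerProductSpace ℂ H]
    (T : H →L[ℂ] H) : ℝ :=
  sInf ((fun z : ℂ => ‖z‖) '' essentialSpectrum T)

end

/-! The necessity argument: an orthonormal family `z` with pairwise orthogonal images and no least
`‖T (z i)‖` spans a closed subspace `M` on which the compression of `T† ∘L T` is diagonal, and
`m(T|_M) ^ 2` is not on the diagonal, so `T|_M` does not attain its minimum. Two points of the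
essential spectrum of different modulus give such a family, because small discs around them have
infinite-dimensional spectral subspaces and the intermediate value theorem on unit spheres then
realizes every value of `‖T z‖` between the two moduli. Infinitely many eigenvalues outside the
circle of radius `b` carrying the essential spectrum give one too, as they accumulate on it.

The sufficiency argument: if the essential spectrum lies on the circle of radius `b`, then
`T† ∘L T - b ^ 2` is compact, being a function of `T` that vanishes there, so `m(T|_M)` is attained
whenever it differs from `b`. If `m(T|_M) = b` and `M` is infinite-dimensional, then `M` meets the
finite-codimensional kernel of `(T† ∘L T - b ^ 2)⁺`, on which `‖T x‖ ≤ b * ‖x‖`.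

For normal `T` this describes the moduli of the essential spectrum and of the eigenvalues; on the
spectrum of a positive operator every point equals its modulus. -/

open scoped InnerProduct InnerProductSpace ComplexOrder

section MinimumModulus

variable {E F : Type*} [NormedAddCommGroup E] [NormedAddCommGroup F]

section NormedSpace

variable [NormedSpace ℂ E] [NormedSpace ℂ F]

theorem minimumModulus_nonneg (S : E →L[ℂ] F) : 0 ≤ minimumModulus S :=
  Real.sInf_nonneg (by rintro _ ⟨x, -, rfl⟩; exact norm_nonneg _)

theorem minimumModulus_le (S : E →L[ℂ] F) {x : E} (hx : ‖x‖ = 1) : minimumModulus S ≤ ‖S x‖ :=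
  csInf_le ⟨0, by rintro _ ⟨y, -, rfl⟩; exact norm_nonneg _⟩ ⟨x, hx, rfl⟩

theorem minimumModulus_mul_norm_le (S : E →L[ℂ] F) (x : E) :
    minimumModulus S * ‖x‖ ≤ ‖S x‖ := by
  rcases eq_or_ne x 0 with rfl | hx
  · simp
  · have h := minimumModulus_le S (norm_smul_inv_norm (𝕜 := ℂ) hx)
    rwa [map_smul, norm_smul, norm_inv, RCLike.norm_ofReal, abs_norm,
      le_inv_mul_iff₀' (norm_pos_iff.2 hx)] at h

theorem le_minimumModulus_sq_iff [Nontrivial E] {S : E →L[ℂ] F} {c : ℝ} :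
    c ≤ minimumModulus S ^ 2 ↔ ∀ x, c * ‖x‖ ^ 2 ≤ ‖S x‖ ^ 2 := by
  constructor
  · intro h x
    calc c * ‖x‖ ^ 2 ≤ minimumModulus S ^ 2 * ‖x‖ ^ 2 := by gcongr
      _ = (minimumModulus S * ‖x‖) ^ 2 := (mul_pow _ _ _).symm
      _ ≤ ‖S x‖ ^ 2 := by
        have := minimumModulus_nonneg S
        gcongr
        exact minimumModulus_mul_norm_le S x
  · intro h
    obtain ⟨x, hx⟩ := exists_ne (0 : E)
    have hsqrt : √c ≤ minimumModulus S := by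
      refine le_csInf ⟨_, _, norm_smul_inv_norm (𝕜 := ℂ) hx, rfl⟩ ?_
      rintro _ ⟨y, hy, rfl⟩
      exact Real.sqrt_le_iff.2 ⟨norm_nonneg _, by simpa [hy] using h y⟩
    exact (Real.sqrt_le_iff.1 hsqrt).2

theorem isMinimumAttaining_of_norm_apply_le {S : E →L[ℂ] F} {x : E} (hx : x ≠ 0)
    (h : ‖S x‖ ≤ minimumModulus S * ‖x‖) : IsMinimumAttaining S := by
  have hx1 := norm_smul_inv_norm (𝕜 := ℂ) hx
  refine ⟨_, hx1, le_antisymm ?_ (minimumModulus_le S hx1)⟩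
  rwa [map_smul, norm_smul, norm_inv, RCLike.norm_ofReal, abs_norm,
    inv_mul_le_iff₀' (norm_pos_iff.2 hx)]

end NormedSpace

section InnerProductSpace

variable [InnerProductSpace ℂ E] [InnerProductSpace ℂ F]

theorem re_inner_ofReal_smul_self (c : ℝ) (x : E) :
    RCLike.re ⟪(c : ℂ) • x, x⟫_ℂ = c * ‖x‖ ^ 2 := by
  rw [inner_smul_left, Complex.conj_ofReal, ← inner_self_eq_norm_sq (𝕜 := ℂ)]
  exact Complex.re_ofReal_mul c _

theorem eq_zero_of_mem_topologicalClosure_span {ι : Type*} {z : ι → E} {x : E}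
    (hx : x ∈ (Submodule.span ℂ (range z)).topologicalClosure) (h : ∀ i, ⟪z i, x⟫_ℂ = 0) :
    x = 0 := by
  have hz : Submodule.span ℂ (range z) ≤ (ℂ ∙ x)ᗮ := Submodule.span_le.2 <|
    range_subset_iff.2 fun i => Submodule.mem_orthogonal_singleton_iff_inner_left.2 (h i)
  have hxx := Submodule.topologicalClosure_minimal _ hz (Submodule.isClosed_orthogonal _) hx
  exact inner_self_eq_zero.1 (Submodule.mem_orthogonal_singleton_iff_inner_left.1 hxx)

variable [CompleteSpace E] [CompleteSpace F]

theorem isMinimumAttaining_iff_hasEigenvalue (S : E →L[ℂ] F) :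
    IsMinimumAttaining S ↔
      Module.End.HasEigenvalue ((S† ∘L S : E →L[ℂ] E) : E →ₗ[ℂ] E)
        ((minimumModulus S ^ 2 : ℝ) : ℂ) := by
  have hsq (x : E) : (S† ∘L S).reApplyInnerSelf x = ‖S x‖ ^ 2 :=
    (S.apply_norm_sq_eq_inner_adjoint_left x).symm
  constructor
  · rintro ⟨x, hx, hmin⟩
    have hextr : IsMinOn (S† ∘L S).reApplyInnerSelf (Metric.sphere 0 ‖x‖) x := by
      intro y hy
      have hy' : ‖y‖ = 1 := by simpa [hx] using hy
      simp only [mem_ofPred_eq, hsq, hmin]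
      gcongr
      · exact minimumModulus_nonneg S
      · exact minimumModulus_le S hy'
    have hvec := S.isPositive_adjoint_comp_self.isSelfAdjoint.hasEigenvector_of_isLocalExtrOn
      (norm_pos_iff.1 (hx ▸ one_pos)) (.inl hextr.localize)
    rw [ContinuousLinearMap.rayleighQuotient, hsq, hx, hmin, one_pow, div_one] at hvec
    exact Module.End.hasEigenvalue_of_hasEigenvector hvec
  · intro h
    obtain ⟨x, hx⟩ := h.exists_hasEigenvector
    refine isMinimumAttaining_of_norm_apply_le hx.2 (le_of_sq_le_sq ?_ ?_)
    · have hx' : (S† ∘L S) x = ((minimumModulus S ^ 2 : ℝ) : ℂ) • x := hx.apply_eq_smul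
      rw [S.apply_norm_sq_eq_inner_adjoint_left, hx', mul_pow, re_inner_ofReal_smul_self]
    · exact mul_nonneg (minimumModulus_nonneg S) (norm_nonneg x)

theorem algebraMap_le_adjoint_comp_self_iff (S : E →L[ℂ] F) (c : ℝ) :
    algebraMap ℝ (E →L[ℂ] E) c ≤ S† ∘L S ↔ ∀ x, c * ‖x‖ ^ 2 ≤ ‖S x‖ ^ 2 := by
  have hsq (x : E) : (S† ∘L S - algebraMap ℝ (E →L[ℂ] E) c).reApplyInnerSelf x =
      ‖S x‖ ^ 2 - c * ‖x‖ ^ 2 := by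
    rw [S.apply_norm_sq_eq_inner_adjoint_left, ContinuousLinearMap.reApplyInnerSelf_apply,
      sub_apply, inner_sub_left, map_sub, Algebra.algebraMap_eq_smul_one,
      smul_apply, one_apply_eq_self,
      ← Complex.coe_smul, re_inner_ofReal_smul_self]
  have hsa : IsSelfAdjoint (S† ∘L S - algebraMap ℝ (E →L[ℂ] E) c) :=
    S.isPositive_adjoint_comp_self.isSelfAdjoint.sub (.algebraMap _ (.all c))
  simp only [ContinuousLinearMap.le_def, ContinuousLinearMap.isPositive_def', hsa, true_and, hsq,
    sub_nonneg]

theorem isLeast_minimumModulus_sq [Nontrivial E] (S : E →L[ℂ] F) :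
    IsLeast (spectrum ℝ (S† ∘L S)) (minimumModulus S ^ 2) := by
  have hsa : IsSelfAdjoint (S† ∘L S) := S.isPositive_adjoint_comp_self.isSelfAdjoint
  obtain ⟨l, hl⟩ := (spectrum.isCompact (𝕜 := ℝ) (S† ∘L S)).exists_isLeast
    (ContinuousFunctionalCalculus.spectrum_nonempty _ hsa)
  suffices l = minimumModulus S ^ 2 from this ▸ hl
  refine eq_of_forall_le_iff fun c => ?_
  rw [le_minimumModulus_sq_iff, ← algebraMap_le_adjoint_comp_self_iff,
    algebraMap_le_iff_le_spectrum, le_isGLB_iff hl.isGLB]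
  rfl

theorem isMinimumAttaining_of_isCompactOperator [Nontrivial E] (S : E →L[ℂ] F) {c : ℝ}
    (hc : c ≠ minimumModulus S ^ 2)
    (hS : IsCompactOperator (S† ∘L S - algebraMap ℝ (E →L[ℂ] E) c)) : IsMinimumAttaining S := by
  have hspec : ((minimumModulus S ^ 2 - c : ℝ) : ℂ) ∈
      spectrum ℂ (S† ∘L S - algebraMap ℝ (E →L[ℂ] E) c) := by
    refine (spectrum.algebraMap_mem_iff ℂ (R := ℝ)).2 ?_
    rw [← spectrum.sub_singleton_eq]
    exact sub_mem_sub (isLeast_minimumModulus_sq S).1 (mem_singleton c)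
  obtain ⟨x, hx⟩ := ((hS.hasEigenvalue_iff_mem_spectrum
    (by exact_mod_cast sub_ne_zero.2 hc.symm)).2 hspec).exists_hasEigenvector
  have hSx : (S† ∘L S) x - (c : ℂ) • x = ((minimumModulus S ^ 2 - c : ℝ) : ℂ) • x :=
    hx.apply_eq_smul
  rw [Complex.ofReal_sub, sub_smul, sub_left_inj] at hSx
  exact (isMinimumAttaining_iff_hasEigenvalue S).2
    (Module.End.hasEigenvalue_of_hasEigenvector ⟨Module.End.mem_eigenspace_iff.2 hSx, hx.2⟩)

theorem isMinimumAttaining_of_finiteDimensional [Nontrivial E] [FiniteDimensional ℂ E]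
    (S : E →L[ℂ] F) : IsMinimumAttaining S :=
  isMinimumAttaining_of_isCompactOperator S (lt_add_one _).ne'
    (isCompactOperator_of_locallyCompactSpace_dom _)

theorem not_isAbsolutelyMinimumAttaining_of_orthonormal {ι : Type*} [Nonempty ι] {T : E →L[ℂ] F}
    {z : ι → E} (hz : Orthonormal ℂ z) (hTz : Pairwise fun i j => ⟪T (z i), T (z j)⟫_ℂ = 0)
    (hmin : ∀ i, ∃ j, ‖T (z j)‖ < ‖T (z i)‖) : ¬ IsAbsolutelyMinimumAttaining T := by
  intro hT
  set M := (Submodule.span ℂ (range z)).topologicalClosure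
  have hMc : IsClosed (M : Set E) := Submodule.isClosed_topologicalClosure _
  have : CompleteSpace M := hMc.completeSpace_coe
  let w (i : ι) : M :=
    ⟨z i, Submodule.le_topologicalClosure _ (Submodule.subset_span (mem_range_self i))⟩
  have hw (i : ι) : ‖w i‖ = 1 := hz.1 i
  have hzero (x : M) (hx : ∀ i, ⟪w i, x⟫_ℂ = 0) : x = 0 :=
    Subtype.ext (eq_zero_of_mem_topologicalClosure_span x.2 hx)
  set S := T.comp M.subtypeL
  have hSw (i : ι) : (S† ∘L S) (w i) = ((‖T (z i)‖ ^ 2 : ℝ) : ℂ) • w i := by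
    refine sub_eq_zero.1 (hzero _ fun j => ?_)
    have hST : ⟪w j, (S† ∘L S) (w i)⟫_ℂ = ⟪T (z j), T (z i)⟫_ℂ :=
      S.adjoint_inner_right (w j) (S (w i))
    rw [inner_sub_right, inner_smul_right, hST, sub_eq_zero]
    rcases eq_or_ne j i with rfl | hji
    · simp [inner_self_eq_norm_sq_to_K, hw]
    · rw [hTz hji, show ⟪w j, w i⟫_ℂ = 0 from hz.2 hji, mul_zero]
  obtain ⟨i₀⟩ := ‹Nonempty ι›
  have hM : M ≠ ⊥ := (Submodule.ne_bot_iff _).2 ⟨z i₀, (w i₀).2, hz.ne_zero i₀⟩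
  obtain ⟨x, hx⟩ := ((isMinimumAttaining_iff_hasEigenvalue S).1 (hT M hMc hM)).exists_hasEigenvector
  refine hx.2 (hzero x fun i => ?_)
  obtain ⟨j, hj⟩ := hmin i
  have hlt : minimumModulus S < ‖T (z i)‖ := (minimumModulus_le S (hw j)).trans_lt hj
  have hne : ‖T (z i)‖ ^ 2 ≠ minimumModulus S ^ 2 :=
    (pow_lt_pow_left₀ hlt (minimumModulus_nonneg S) two_ne_zero).ne'
  have hsymm : ((S† ∘L S : M →L[ℂ] M) : M →ₗ[ℂ] M).IsSymmetric :=
    S.isPositive_adjoint_comp_self.isSymmetric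
  exact hsymm.orthogonalFamily_eigenspaces (Complex.ofReal_injective.ne hne)
    ⟨w i, Module.End.mem_eigenspace_iff.2 (hSw i)⟩ ⟨x, hx.1⟩

end InnerProductSpace

end MinimumModulus

theorem continuousOn_indicator_of_finite {X Y : Type*} [TopologicalSpace X] [T1Space X]
    [TopologicalSpace Y] [Zero Y] {s t : Set X} (hs : s.Finite)
    (hst : ∀ x ∈ s, ¬ AccPt x (𝓟 t)) (f : X → Y) : ContinuousOn (s.indicator f) t := by
  intro x _
  by_cases hx : AccPt x (𝓟 t)
  · have h0 : s.indicator f =ᶠ[𝓝 x] fun _ => 0 := by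
      filter_upwards [hs.isClosed.isOpen_compl.mem_nhds fun hxs => hst x hxs hx] with y hy
      exact indicator_of_notMem hy f
    exact (continuousAt_const.congr h0.symm).continuousWithinAt
  · exact continuousWithinAt_of_not_accPt hx

theorem continuousOn_indicator_singleton {X Y : Type*} [TopologicalSpace X] [T1Space X]
    [TopologicalSpace Y] [Zero Y] {x : X} {t : Set X} (hx : ¬ AccPt x (𝓟 t)) (f : X → Y) :
    ContinuousOn (indicator {x} f) t :=
  continuousOn_indicator_of_finite (finite_singleton x) (by simpa using hx) f

theorem isCompactOperator_of_finiteDimensional_range {𝕜 E F : Type*}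
    [NontriviallyNormedField 𝕜] [LocallyCompactSpace 𝕜] [NormedAddCommGroup E] [NormedSpace 𝕜 E]
    [NormedAddCommGroup F] [NormedSpace 𝕜 F] (A : E →L[𝕜] F) [FiniteDimensional 𝕜 A.range] :
    IsCompactOperator A := by
  have : ProperSpace A.range := FiniteDimensional.proper 𝕜 _
  have h1 : IsCompactOperator (A.codRestrict A.range fun x => ⟨x, rfl⟩) :=
    isCompactOperator_of_locallyCompactSpace_dom _
  exact h1.clm_comp A.range.subtypeL

theorem exists_mem_ne_zero_map_eq_zero {K V V' : Type*} [DivisionRing K] [AddCommGroup V]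
    [Module K V] [AddCommGroup V'] [Module K V'] {W : Submodule K V} (hW : ¬ FiniteDimensional K W)
    (L : V →ₗ[K] V') [FiniteDimensional K V'] : ∃ x ∈ W, x ≠ 0 ∧ L x = 0 := by
  by_contra! h
  refine hW (FiniteDimensional.of_injective (L ∘ₗ W.subtype) ?_)
  rw [injective_iff_map_eq_zero]
  intro x hx
  by_contra hx0
  exact h x x.2 (by simpa using hx0) hx

theorem exists_aeval_mul_eq_zero {K V : Type*} [Field K] [AddCommGroup V] [Module K V]
    {T A : Module.End K V} (hTA : Commute T A) [FiniteDimensional K A.range] :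
    ∃ p : Polynomial K, p ≠ 0 ∧ Polynomial.aeval T p * A = 0 := by
  have hmaps : ∀ y ∈ A.range, T y ∈ A.range := by
    rintro _ ⟨x, rfl⟩
    exact ⟨T x, (LinearMap.congr_fun hTA.eq x).symm⟩
  let R : Module.End K A.range := T.restrict hmaps
  have hpow (n : ℕ) (y : A.range) : ((R ^ n) y : V) = (T ^ n) y := by
    induction n generalizing y with
    | zero => rfl
    | succ n ih =>
      rw [pow_succ, pow_succ]
      exact ih (R y)
  have hR (p : Polynomial K) (y : A.range) :
      (Polynomial.aeval R p y : V) = Polynomial.aeval T p y := by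
    simp [Polynomial.aeval_eq_sum_range, hpow]
  refine ⟨minpoly K R, minpoly.ne_zero (Algebra.IsIntegral.isIntegral R), ?_⟩
  ext x
  simpa using (hR (minpoly K R) ⟨A x, x, rfl⟩).symm

section Spectrum

variable {H : Type*} [NormedAddCommGroup H] [InnerProductSpace ℂ H] [CompleteSpace H]
  {T : H →L[ℂ] H}

theorem exists_accPt_mem_essentialSpectrum {s : Set ℂ} (hs : s.Infinite)
    (hsT : s ⊆ spectrum ℂ T) : ∃ z ∈ essentialSpectrum T, AccPt z (𝓟 s) := by
  obtain ⟨z, hz, hacc⟩ := hs.exists_accPt_of_subset_isCompact (spectrum.isCompact T) hsT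
  exact ⟨z, ⟨hz, fun hd => hd.2.2 (hacc.mono (principal_mono.2 hsT))⟩, hacc⟩

theorem finite_of_disjoint_essentialSpectrum {s : Set ℂ} (hs : IsClosed s)
    (hsT : s ⊆ spectrum ℂ T) (hess : Disjoint s (essentialSpectrum T)) : s.Finite := by
  by_contra hinf
  obtain ⟨z, hz, hacc⟩ := exists_accPt_mem_essentialSpectrum hinf hsT
  exact disjoint_left.1 hess (isClosed_iff_clusterPt.1 hs z hacc.clusterPt) hz

theorem mem_spectrum_of_hasEigenvalue {z : ℂ}
    (hz : Module.End.HasEigenvalue (T : H →ₗ[ℂ] H) z) : z ∈ spectrum ℂ T := by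
  rw [ContinuousLinearMap.spectrum_eq]
  exact hz.mem_spectrum

/-- The Riesz projection of a normal operator onto an isolated point `z` of its spectrum. -/
noncomputable def rieszProjection (T : H →L[ℂ] H) (z : ℂ) : H →L[ℂ] H :=
  cfc (indicator {z} 1) T

theorem cfc_eq_sum_smul_rieszProjection {f : ℂ → ℂ} {s : Finset ℂ}
    (hs : ∀ z ∈ s, ¬ AccPt z (𝓟 (spectrum ℂ T))) (hf : ∀ z ∈ spectrum ℂ T, z ∉ s → f z = 0) :
    cfc f T = ∑ z ∈ s, f z • rieszProjection T z := by
  have hcont (z : ℂ) (hz : z ∈ s) := continuousOn_indicator_singleton (hs z hz) (1 : ℂ → ℂ)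
  calc cfc f T = cfc (∑ z ∈ s, fun w => f z • indicator {z} 1 w) T := by
        refine cfc_congr fun w hw => ?_
        rw [Finset.sum_apply, Finset.sum_eq_single w]
        · simp
        · intro z _ hzw
          simp [hzw.symm]
        · intro hws
          simp [hf w hw hws]
    _ = ∑ z ∈ s, cfc (fun w => f z • indicator {z} 1 w) T :=
        cfc_sum _ T s fun z hz => ContinuousOn.fun_const_smul (hcont z hz) (f z)
    _ = ∑ z ∈ s, f z • rieszProjection T z :=
        Finset.sum_congr rfl fun z hz => cfc_smul (f z) _ T (hcont z hz)

/-- The spectral subspace of a normal operator `T` for the closed disc of centre `a` and radius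
`r`, as the kernel of a function of `T` that vanishes exactly on that disc. -/
noncomputable def discSpectralSubspace (T : H →L[ℂ] H) (a : ℂ) (r : ℝ) : Submodule ℂ H :=
  (cfc (fun z => ((max (‖z - a‖ ^ 2 - r ^ 2) 0 : ℝ) : ℂ)) T).ker

theorem range_cfc_le_discSpectralSubspace {f : ℂ → ℂ} (hf : ContinuousOn f (spectrum ℂ T)) {a : ℂ}
    {r : ℝ} (hfr : ∀ z, r < ‖z - a‖ → f z = 0) :
    (cfc f T).range ≤ discSpectralSubspace T a r := by
  rintro _ ⟨x, rfl⟩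
  have h0 : cfc (fun z => ((max (‖z - a‖ ^ 2 - r ^ 2) 0 : ℝ) : ℂ)) T * cfc f T = 0 := by
    rw [← cfc_mul _ _ T, ← cfc_zero ℂ T]
    refine cfc_congr fun z _ => ?_
    rcases lt_or_ge r ‖z - a‖ with h | h
    · simp [hfr z h]
    · simp [max_eq_right (sub_nonpos.2 (pow_le_pow_left₀ (norm_nonneg _) h 2))]
  exact DFunLike.congr_fun h0 x

variable [IsStarNormal T]

theorem cfc_id_sub_const (z : ℂ) : cfc (fun w => w - z) T = T - algebraMap ℂ (H →L[ℂ] H) z := by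
  rw [cfc_sub _ _ T, cfc_id' ℂ T, cfc_const z T]

theorem range_rieszProjection {z : ℂ} (hz : ¬ AccPt z (𝓟 (spectrum ℂ T))) :
    (rieszProjection T z).range = Module.End.eigenspace (T : H →ₗ[ℂ] H) z := by
  have hcont := continuousOn_indicator_singleton hz (1 : ℂ → ℂ)
  have hid : ContinuousOn (fun w => w - z) (spectrum ℂ T) := by fun_prop
  have hker (x : H) : (T - algebraMap ℂ (H →L[ℂ] H) z) x = 0 ↔
      x ∈ Module.End.eigenspace (T : H →ₗ[ℂ] H) z := by
    simp [Algebra.algebraMap_eq_smul_one, sub_eq_zero]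
  apply le_antisymm
  · rintro _ ⟨x, rfl⟩
    have h0 : (T - algebraMap ℂ (H →L[ℂ] H) z) * rieszProjection T z = 0 := by
      rw [rieszProjection, ← cfc_id_sub_const, ← cfc_mul _ _ T hid hcont, ← cfc_zero ℂ T]
      refine cfc_congr fun w _ => ?_
      by_cases hw : w = z <;> simp [hw]
    exact (hker _).1 (DFunLike.congr_fun h0 x)
  · intro x hx
    have hinv : ContinuousOn (fun w => (w - z)⁻¹) (spectrum ℂ T) := by
      intro w hw
      rcases eq_or_ne w z with rfl | hwz
      · exact continuousWithinAt_of_not_accPt hz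
      · exact (hid w hw).inv₀ (sub_ne_zero.2 hwz)
    have h1 : rieszProjection T z +
        cfc (fun w => (w - z)⁻¹) T * (T - algebraMap ℂ (H →L[ℂ] H) z) = 1 := by
      rw [rieszProjection, ← cfc_id_sub_const, ← cfc_mul _ _ T hinv hid,
        ← cfc_add T _ (fun w => (w - z)⁻¹ * (w - z)) hcont (hinv.mul hid), ← cfc_one ℂ T]
      refine cfc_congr fun w _ => ?_
      by_cases hw : w = z
      · simp [hw]
      · simp [hw, sub_ne_zero.2 hw]
    refine ⟨x, ?_⟩
    simpa [(hker x).2 hx] using DFunLike.congr_fun h1 x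

theorem hasEigenvalue_of_not_accPt {z : ℂ} (hzT : z ∈ spectrum ℂ T)
    (hz : ¬ AccPt z (𝓟 (spectrum ℂ T))) : Module.End.HasEigenvalue (T : H →ₗ[ℂ] H) z := by
  rw [Module.End.hasEigenvalue_iff, ← range_rieszProjection hz, Ne, LinearMap.range_eq_bot]
  intro h0
  have h0' : cfc (indicator {z} 1) T = cfc (0 : ℂ → ℂ) T := by
    rw [cfc_zero]
    exact ContinuousLinearMap.coe_injective h0
  have := eqOn_of_cfc_eq_cfc h0' (continuousOn_indicator_singleton hz 1) continuousOn_const ‹_› hzT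
  simp at this

theorem finiteDimensional_range_cfc {f : ℂ → ℂ} (hfin : {z ∈ spectrum ℂ T | f z ≠ 0}.Finite)
    (hdisc : {z ∈ spectrum ℂ T | f z ≠ 0} ⊆ discreteSpectrum T) :
    FiniteDimensional ℂ (cfc f T).range := by
  set s := hfin.toFinset with hs_def
  have hs (z : ℂ) (hz : z ∈ s) : z ∈ discreteSpectrum T := hdisc (hfin.mem_toFinset.1 hz)
  have hsum := cfc_eq_sum_smul_rieszProjection (f := f) (fun z hz => (hs z hz).2.2)
    (by simp +contextual [hs_def])
  have hfd (z : s) : FiniteDimensional ℂ (rieszProjection T z).range := by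
    rw [range_rieszProjection (hs z z.2).2.2]
    exact (hs z z.2).2.1
  refine Submodule.finiteDimensional_of_le (S₂ := ⨆ z : s, (rieszProjection T z).range) ?_
  rintro _ ⟨x, rfl⟩
  rw [hsum, ContinuousLinearMap.coe_coe, sum_apply]
  exact Submodule.sum_mem _ fun z hz => Submodule.smul_mem _ _ <|
    Submodule.mem_iSup_of_mem (⟨z, hz⟩ : s) ⟨x, rfl⟩

theorem finite_of_finiteDimensional_range_cfc {f : ℂ → ℂ} (hf : ContinuousOn f (spectrum ℂ T))
    [FiniteDimensional ℂ (cfc f T).range] : {z ∈ spectrum ℂ T | f z ≠ 0}.Finite := by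
  have hcomm : Commute T (cfc f T) := by
    simpa only [cfc_id ℂ T] using cfc_commute_cfc id f T
  have hcomm' : Commute (T : H →ₗ[ℂ] H) (cfc f T : H →L[ℂ] H) :=
    hcomm.map (ContinuousLinearMap.toLinearMapRingHom (R₁ := ℂ) (M₁ := H))
  obtain ⟨p, hp, hpf⟩ := exists_aeval_mul_eq_zero hcomm'
  have hcoe : ((Polynomial.aeval T p : H →L[ℂ] H) : H →ₗ[ℂ] H) =
      Polynomial.aeval (T : H →ₗ[ℂ] H) p :=
    Polynomial.hom_eval₂ p (algebraMap ℂ (H →L[ℂ] H)) ContinuousLinearMap.toLinearMapRingHom T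
  have hpf' : Polynomial.aeval T p * cfc f T = 0 := by
    rw [← hcoe] at hpf
    exact ContinuousLinearMap.coe_injective hpf
  rw [← cfc_polynomial p T, ← cfc_mul _ _ T p.continuousOn hf, ← cfc_zero ℂ T] at hpf'
  have hzero := eqOn_of_cfc_eq_cfc hpf' (p.continuousOn.mul hf) continuousOn_const
  refine (p.rootSet_finite ℂ).subset fun z hz => ?_
  rw [Polynomial.mem_rootSet, Polynomial.coe_aeval_eq_eval]
  exact ⟨hp, (mul_eq_zero.1 (hzero hz.1)).resolve_right hz.2⟩

theorem mem_discreteSpectrum_of_finiteDimensional_range_cfc {f : ℂ → ℂ}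
    (hf : ContinuousOn f (spectrum ℂ T)) [FiniteDimensional ℂ (cfc f T).range]
    {z : ℂ} (hz : z ∈ spectrum ℂ T) (hfz : f z ≠ 0) : z ∈ discreteSpectrum T := by
  have hacc : ¬ AccPt z (𝓟 (spectrum ℂ T)) := by
    intro hacc
    have hnear : ∀ᶠ w in 𝓝 z, w ∈ spectrum ℂ T → f w ≠ 0 :=
      eventually_nhdsWithin_iff.1 ((hf z hz).eventually_ne hfz)
    have hacc' : AccPt z (𝓟 {w ∈ spectrum ℂ T | f w ≠ 0}) :=
      accPt_iff_frequently.2 <| ((accPt_iff_frequently.1 hacc).and_eventually hnear).mono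
        fun w hw => ⟨hw.1.1, hw.1.2, hw.2 hw.1.2⟩
    exact Set.Infinite.of_accPt hacc' (finite_of_finiteDimensional_range_cfc hf)
  have hcont := continuousOn_indicator_singleton hacc (1 : ℂ → ℂ)
  have hmul : rieszProjection T z = cfc f T * cfc (fun w => (f z)⁻¹ • indicator {z} 1 w) T := by
    rw [rieszProjection, ← cfc_mul _ _ T hf (ContinuousOn.fun_const_smul hcont (f z)⁻¹)]
    refine cfc_congr fun w _ => ?_
    by_cases hw : w = z <;> simp [hw, hfz]
  refine ⟨hasEigenvalue_of_not_accPt hz hacc, ?_, hacc⟩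
  rw [← range_rieszProjection hacc]
  refine Submodule.finiteDimensional_of_le (S₂ := (cfc f T).range) ?_
  rw [hmul]
  exact LinearMap.range_comp_le_range _ _

theorem isCompactOperator_cfc {f : ℂ → ℂ} (hf : ContinuousOn f (spectrum ℂ T))
    (hess : ∀ z ∈ essentialSpectrum T, f z = 0) : IsCompactOperator (cfc f T : H →L[ℂ] H) := by
  -- Off the finite set `s ε` of discrete points, `f` is below `ε` and may be cut off to zero.
  let s (ε : ℝ) : Set ℂ := {z ∈ spectrum ℂ T | ε ≤ ‖f z‖}
  have hdisj {ε : ℝ} (hε : 0 < ε) : Disjoint (s ε) (essentialSpectrum T) :=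
    disjoint_left.2 fun z hz hz' => hε.not_ge (by simpa [hess z hz'] using hz.2)
  have hdisc {ε : ℝ} (hε : 0 < ε) : s ε ⊆ discreteSpectrum T := fun z hz =>
    by_contra fun hd => disjoint_left.1 (hdisj hε) hz ⟨hz.1, hd⟩
  have hfin {ε : ℝ} (hε : 0 < ε) : (s ε).Finite :=
    finite_of_disjoint_essentialSpectrum
      (hf.norm.preimage_isClosed_of_isClosed (spectrum.isClosed T) isClosed_Ici)
      (fun z hz => hz.1) (hdisj hε)
  have hcompact {ε : ℝ} (hε : 0 < ε) :
      IsCompactOperator (cfc ((s ε).indicator f) T : H →L[ℂ] H) := by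
    have hsub : {z ∈ spectrum ℂ T | (s ε).indicator f z ≠ 0} ⊆ s ε :=
      fun z hz => mem_of_indicator_ne_zero hz.2
    have := finiteDimensional_range_cfc ((hfin hε).subset hsub) (hsub.trans (hdisc hε))
    exact isCompactOperator_of_finiteDimensional_range _
  have hdist {ε : ℝ} (hε : 0 < ε) : ‖cfc ((s ε).indicator f) T - cfc f T‖ ≤ ε := by
    rw [← cfc_sub _ _ T (continuousOn_indicator_of_finite (hfin hε)
      (fun z hz => (hdisc hε hz).2.2) f) hf]
    refine norm_cfc_le hε.le fun z hz => ?_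
    by_cases hzs : z ∈ s ε
    · simpa [hzs] using hε.le
    · have : ‖f z‖ < ε := by_contra fun h => hzs ⟨hz, not_lt.1 h⟩
      simpa [hzs] using this.le
  refine isCompactOperator_of_tendsto (l := 𝓝[>] (0 : ℝ))
    (F := fun ε => cfc ((s ε).indicator f) T) ?_ ?_
  · rw [tendsto_iff_norm_sub_tendsto_zero]
    refine squeeze_zero' (Eventually.of_forall fun _ => norm_nonneg _) ?_
      (tendsto_id.mono_left nhdsWithin_le_nhds)
    filter_upwards [self_mem_nhdsWithin] with ε hε using hdist hε
  · filter_upwards [self_mem_nhdsWithin] with ε hε using hcompact hε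

theorem essentialSpectrum_nonempty (hH : ¬ FiniteDimensional ℂ H) (T : H →L[ℂ] H)
    [IsStarNormal T] : (essentialSpectrum T).Nonempty := by
  by_contra! hempty
  have h1 : IsCompactOperator (cfc (1 : ℂ → ℂ) T : H →L[ℂ] H) :=
    isCompactOperator_cfc continuousOn_const (by simp [hempty])
  rw [cfc_one ℂ T] at h1
  exact hH (.of_isCompactOperator_id h1)

theorem cfc_norm_sub_sq_sub (a : ℂ) (c : ℝ) :
    cfc (fun z => ((‖z - a‖ ^ 2 - c : ℝ) : ℂ)) T =
      (T - algebraMap ℂ _ a)† ∘L (T - algebraMap ℂ _ a) - algebraMap ℝ (H →L[ℂ] H) c := by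
  have hfun : (fun z => ((‖z - a‖ ^ 2 - c : ℝ) : ℂ)) =
      fun z => star (z - a) * (z - a) - (c : ℂ) := by
    ext z
    rw [Complex.star_def, Complex.conj_mul', Complex.ofReal_sub, Complex.ofReal_pow]
  rw [hfun, cfc_sub _ _ T, cfc_mul _ _ T, cfc_star, cfc_id_sub_const, cfc_const (c : ℂ) T]
  rfl

theorem norm_sub_smul_le_of_mem_discSpectralSubspace {a : ℂ} {r : ℝ} (hr : 0 ≤ r) {x : H}
    (hx : x ∈ discSpectralSubspace T a r) : ‖T x - a • x‖ ≤ r * ‖x‖ := by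
  set S := T - algebraMap ℂ (H →L[ℂ] H) a
  have hSx : S x = T x - a • x := by simp [S, Algebra.algebraMap_eq_smul_one]
  have hle : S† ∘L S - algebraMap ℝ (H →L[ℂ] H) (r ^ 2) ≤
      cfc (fun z => ((max (‖z - a‖ ^ 2 - r ^ 2) 0 : ℝ) : ℂ)) T := by
    rw [← cfc_norm_sub_sq_sub]
    exact cfc_mono fun z _ => Complex.real_le_real.2 (le_max_left _ _)
  have hpos := ((ContinuousLinearMap.le_def _ _).1 hle).re_inner_nonneg_left x
  have hx0 : cfc (fun z => ((max (‖z - a‖ ^ 2 - r ^ 2) 0 : ℝ) : ℂ)) T x = 0 := hx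
  rw [sub_apply, hx0, zero_sub, sub_apply, neg_sub, inner_sub_left, map_sub, sub_nonneg,
    ← S.apply_norm_sq_eq_inner_adjoint_left, hSx, Algebra.algebraMap_eq_smul_one, smul_apply,
    one_apply_eq_self, ← Complex.coe_smul, re_inner_ofReal_smul_self, ← mul_pow] at hpos
  exact le_of_sq_le_sq hpos (by positivity)

theorem not_finiteDimensional_discSpectralSubspace {a : ℂ} (ha : a ∈ essentialSpectrum T) {r : ℝ}
    (hr : 0 < r) : ¬ FiniteDimensional ℂ (discSpectralSubspace T a r) := by
  intro hfin
  let f (z : ℂ) : ℂ := (max (r - ‖z - a‖) 0 : ℝ)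
  have hf : ContinuousOn f (spectrum ℂ T) := by fun_prop
  have hle : (cfc f T).range ≤ discSpectralSubspace T a r :=
    range_cfc_le_discSpectralSubspace hf fun z hz => by simp [f, hz.le]
  have := Submodule.finiteDimensional_of_le hle
  exact ha.2 (mem_discreteSpectrum_of_finiteDimensional_range_cfc hf ha.1 (by simp [f, hr]))

theorem exists_mem_orthogonal_norm_sub_smul_le {a : ℂ} (ha : a ∈ essentialSpectrum T)
    (V : Submodule ℂ H) [FiniteDimensional ℂ V] {ε : ℝ} (hε : 0 < ε) :
    ∃ x ∈ Vᗮ, ‖x‖ = 1 ∧ ‖T x - a • x‖ ≤ ε := by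
  obtain ⟨x, hxD, hx0, hxV⟩ := exists_mem_ne_zero_map_eq_zero
    (not_finiteDimensional_discSpectralSubspace ha hε) V.orthogonalProjectionOnto.toLinearMap
  have hx1 : ‖(‖x‖ : ℂ)⁻¹ • x‖ = 1 := norm_smul_inv_norm hx0
  have hxV' : x ∈ Vᗮ := Submodule.orthogonalProjectionOnto_eq_zero_iff.1 hxV
  refine ⟨_, Submodule.smul_mem _ _ hxV', hx1, ?_⟩
  simpa only [hx1, mul_one] using
    norm_sub_smul_le_of_mem_discSpectralSubspace hε.le (Submodule.smul_mem _ (‖x‖ : ℂ)⁻¹ hxD)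

theorem exists_mem_orthogonal_norm_apply_eq {a b : ℂ} (ha : a ∈ essentialSpectrum T)
    (hb : b ∈ essentialSpectrum T) {d : ℝ} (had : ‖a‖ < d) (hdb : d < ‖b‖)
    (V : Submodule ℂ H) [FiniteDimensional ℂ V] : ∃ z ∈ Vᗮ, ‖z‖ = 1 ∧ ‖T z‖ = d := by
  obtain ⟨x, hxV, hx1, hx⟩ := exists_mem_orthogonal_norm_sub_smul_le ha V (sub_pos.2 had)
  obtain ⟨y, hyV, hy1, hy⟩ := exists_mem_orthogonal_norm_sub_smul_le hb V (sub_pos.2 hdb)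
  have hxd : ‖T x‖ ≤ d := by
    have h1 := norm_sub_norm_le (T x) (a • x)
    rw [norm_smul, hx1] at h1
    linarith
  have hyd : d ≤ ‖T y‖ := by
    have h1 := norm_sub_norm_le (b • y) (T y)
    rw [norm_smul, hy1, norm_sub_rev] at h1
    linarith
  have hx0 : x ≠ 0 := norm_ne_zero_iff.1 (hx1 ▸ one_ne_zero)
  have : Nontrivial Vᗮ :=
    Submodule.nontrivial_iff_ne_bot.2 ((Submodule.ne_bot_iff _).2 ⟨x, hxV, hx0⟩)
  have hrank : 1 < Module.rank ℝ Vᗮ :=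
    calc (1 : Cardinal) < 2 * 1 := by norm_num
      _ ≤ 2 * Module.rank ℂ Vᗮ := by gcongr; exact Cardinal.one_le_iff_pos.2 rank_pos
      _ = Module.rank ℝ Vᗮ := (rank_real_of_complex _).symm
  obtain ⟨z, hz, hzd⟩ := (isPreconnected_sphere hrank (0 : Vᗮ) 1).intermediate_value
    (a := ⟨x, hxV⟩) (b := ⟨y, hyV⟩) (by simpa using hx1) (by simpa using hy1)
    (f := fun z : Vᗮ => ‖T z‖) (by fun_prop) ⟨hxd, hyd⟩
  exact ⟨z, z.2, by simpa using hz, hzd⟩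

theorem IsAbsolutelyMinimumAttaining.norm_le_of_mem_essentialSpectrum
    (hT : IsAbsolutelyMinimumAttaining T) {a b : ℂ} (ha : a ∈ essentialSpectrum T)
    (hb : b ∈ essentialSpectrum T) : ‖b‖ ≤ ‖a‖ := by
  classical
  by_contra! hab
  have hstep (s : Finset H) (hs : ∀ x ∈ s, ‖x‖ = 1 ∧ ‖a‖ < ‖T x‖) :
      ∃ y, (‖y‖ = 1 ∧ ‖a‖ < ‖T y‖) ∧
        ∀ x ∈ s, ⟪x, y⟫_ℂ = 0 ∧ ⟪T x, T y⟫_ℂ = 0 ∧ ‖T y‖ < ‖T x‖ := by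
    have hev : ∀ᶠ d in 𝓝[>] ‖a‖, ‖a‖ < d ∧ d < ‖b‖ ∧ ∀ x ∈ s, d < ‖T x‖ :=
      eventually_mem_nhdsWithin.and <| eventually_nhdsWithin_of_eventually_nhds <|
        (eventually_lt_nhds hab).and <| (eventually_all_finset s).2 fun x hx =>
          eventually_lt_nhds (hs x hx).2
    obtain ⟨d, had, hdb, hd⟩ := hev.exists
    let t : Finset H := s ∪ s.image (T† ∘L T)
    obtain ⟨y, hyV, hy1, hyd⟩ :=
      exists_mem_orthogonal_norm_apply_eq ha hb had hdb (Submodule.span ℂ (t : Set H))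
    have hort (u : H) (hu : u ∈ t) : ⟪u, y⟫_ℂ = 0 :=
      (Submodule.mem_orthogonal _ _).1 hyV u (Submodule.subset_span hu)
    refine ⟨y, ⟨hy1, hyd ▸ had⟩, fun x hx => ⟨hort x (Finset.mem_union_left _ hx), ?_,
      hyd ▸ hd x hx⟩⟩
    rw [← T.adjoint_inner_left]
    exact hort _ (Finset.mem_union_right _ (Finset.mem_image_of_mem _ hx))
  obtain ⟨z, hz, hr⟩ := exists_seq_of_forall_finset_exists _ _ hstep
  have horth : Pairwise fun m n => ⟪z m, z n⟫_ℂ = 0 ∧ ⟪T (z m), T (z n)⟫_ℂ = 0 := by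
    intro m n hmn
    rcases hmn.lt_or_gt with h | h
    · exact ⟨(hr m n h).1, (hr m n h).2.1⟩
    · exact ⟨inner_eq_zero_symm.1 (hr n m h).1, inner_eq_zero_symm.1 (hr n m h).2.1⟩
  exact not_isAbsolutelyMinimumAttaining_of_orthonormal
    ⟨fun n => (hz n).1, fun m n hmn => (horth hmn).1⟩ (fun m n hmn => (horth hmn).2)
    (fun n => ⟨n + 1, (hr n (n + 1) n.lt_succ_self).2.2⟩) hT

theorem adjoint_apply_eq_smul {z : ℂ} {x : H} (hx : T x = z • x) : (T†) x = star z • x := by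
  have hnormal : IsStarNormal (T - algebraMap ℂ (H →L[ℂ] H) z) := by
    rw [← cfc_id_sub_const]
    exact cfc_predicate _ T
  have h0 := (ContinuousLinearMap.IsStarNormal.adjoint_apply_eq_zero_iff hnormal x).2
    (by simp [hx, Algebra.algebraMap_eq_smul_one])
  rw [← ContinuousLinearMap.star_eq_adjoint, star_sub, ← algebraMap_star_comm,
    Algebra.algebraMap_eq_smul_one] at h0
  exact sub_eq_zero.1 h0

theorem inner_eq_zero_of_apply_eq_smul {z w : ℂ} (hzw : z ≠ w) {x y : H} (hx : T x = z • x)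
    (hy : T y = w • y) : ⟪x, y⟫_ℂ = 0 := by
  have h : z * ⟪y, x⟫_ℂ = w * ⟪y, x⟫_ℂ := by
    rw [← inner_smul_right, ← hx, ← T.adjoint_inner_left, adjoint_apply_eq_smul hy,
      inner_smul_left, Complex.star_def, Complex.conj_conj]
  exact inner_eq_zero_symm.1 ((mul_eq_mul_right_iff.1 h).resolve_left hzw)

theorem IsAbsolutelyMinimumAttaining.finite_setOf_hasEigenvalue
    (hT : IsAbsolutelyMinimumAttaining T) {b : ℝ} (hess : ∀ z ∈ essentialSpectrum T, ‖z‖ ≤ b) :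
    {z : ℂ | b < ‖z‖ ∧ Module.End.HasEigenvalue (T : H →ₗ[ℂ] H) z}.Finite := by
  set s := {z : ℂ | b < ‖z‖ ∧ Module.End.HasEigenvalue (T : H →ₗ[ℂ] H) z}
  by_contra hinf
  obtain ⟨z₀, hz₀, hacc⟩ := exists_accPt_mem_essentialSpectrum hinf
    fun z hz => mem_spectrum_of_hasEigenvalue hz.2
  have hbelow (z : s) : ∃ w : s, ‖(w : ℂ)‖ < ‖(z : ℂ)‖ := by
    have hnear : ∀ᶠ w : ℂ in 𝓝 z₀, ‖w‖ < ‖(z : ℂ)‖ :=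
      continuous_norm.continuousAt.eventually_lt_const ((hess z₀ hz₀).trans_lt z.2.1)
    obtain ⟨w, ⟨-, hw⟩, hwz⟩ := ((accPt_iff_frequently.1 hacc).and_eventually hnear).exists
    exact ⟨⟨w, hw⟩, hwz⟩
  have hunit (z : s) : ∃ x : H, ‖x‖ = 1 ∧ T x = (z : ℂ) • x := by
    obtain ⟨x, hx⟩ := z.2.2.exists_hasEigenvector
    exact ⟨_, norm_smul_inv_norm (𝕜 := ℂ) hx.2,
      Module.End.mem_eigenspace_iff.1 (Submodule.smul_mem _ _ hx.1)⟩
  choose x hx1 hx using hunit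
  have horth : Pairwise fun z w => ⟪x z, x w⟫_ℂ = 0 := fun z w hzw =>
    inner_eq_zero_of_apply_eq_smul (Subtype.coe_injective.ne hzw) (hx z) (hx w)
  have : Nonempty s := (Set.Infinite.nonempty hinf).to_subtype
  refine not_isAbsolutelyMinimumAttaining_of_orthonormal ⟨hx1, horth⟩ (fun z w hzw => ?_)
    (fun z => ?_) hT
  · simp only [hx, inner_smul_left, inner_smul_right, horth hzw, mul_zero, mul_zero]
  · simpa only [hx, norm_smul, hx1, mul_one] using hbelow z

theorem isCompactOperator_restrict_adjoint_comp_self_sub {b : ℝ}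
    (hess : ∀ z ∈ essentialSpectrum T, ‖z‖ = b) (M : Submodule ℂ H) [CompleteSpace M] :
    IsCompactOperator ((T ∘L M.subtypeL)† ∘L (T ∘L M.subtypeL) -
      algebraMap ℝ (M →L[ℂ] M) (b ^ 2)) := by
  have hcfc : cfc (fun z => ((‖z‖ ^ 2 - b ^ 2 : ℝ) : ℂ)) T =
      T† ∘L T - algebraMap ℝ (H →L[ℂ] H) (b ^ 2) := by
    simpa only [sub_zero, map_zero] using cfc_norm_sub_sq_sub (T := T) 0 (b ^ 2)
  have hcompact : IsCompactOperator (cfc (fun z => ((‖z‖ ^ 2 - b ^ 2 : ℝ) : ℂ)) T : H →L[ℂ] H) :=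
    isCompactOperator_cfc (by fun_prop) fun z hz => by simp [hess z hz]
  have hcompress : (T ∘L M.subtypeL)† ∘L (T ∘L M.subtypeL) - algebraMap ℝ (M →L[ℂ] M) (b ^ 2) =
      M.subtypeL† ∘L (T† ∘L T - algebraMap ℝ (H →L[ℂ] H) (b ^ 2)) ∘L M.subtypeL := by
    ext x
    simp [Algebra.algebraMap_eq_smul_one, ContinuousLinearMap.adjoint_comp,
      Submodule.adjoint_subtypeL]
  rw [hcompress, ← hcfc]
  exact (hcompact.comp_clm M.subtypeL).clm_comp (M.subtypeL†)

theorem finiteDimensional_quotient_discSpectralSubspace {a : ℂ} {r : ℝ}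
    (hess : ∀ z ∈ essentialSpectrum T, ‖z - a‖ ≤ r)
    (hfin : {z : ℂ | r < ‖z - a‖ ∧ Module.End.HasEigenvalue (T : H →ₗ[ℂ] H) z}.Finite) :
    FiniteDimensional ℂ (H ⧸ discSpectralSubspace T a r) := by
  let f (z : ℂ) : ℂ := (max (‖z - a‖ ^ 2 - r ^ 2) 0 : ℝ)
  have hlt {z : ℂ} (hz : f z ≠ 0) : r < ‖z - a‖ := by
    by_contra! h
    exact hz (by simpa [f] using pow_le_pow_left₀ (norm_nonneg (z - a)) h 2)
  have hdisc : {z ∈ spectrum ℂ T | f z ≠ 0} ⊆ discreteSpectrum T := fun z hz =>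
    by_contra fun hd => (hlt hz.2).not_ge (hess z ⟨hz.1, hd⟩)
  have := finiteDimensional_range_cfc (hfin.subset fun z hz => ⟨hlt hz.2, (hdisc hz).1⟩) hdisc
  exact Module.Finite.equiv (cfc f T).toLinearMap.quotKerEquivRange.symm

theorem isAbsolutelyMinimumAttaining_of_norm_eq_of_mem_essentialSpectrum {b : ℝ} (hb : 0 ≤ b)
    (hess : ∀ z ∈ essentialSpectrum T, ‖z‖ = b)
    (hfin : {z : ℂ | b < ‖z‖ ∧ Module.End.HasEigenvalue (T : H →ₗ[ℂ] H) z}.Finite) :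
    IsAbsolutelyMinimumAttaining T := by
  intro M hM hMbot
  have : CompleteSpace M := hM.completeSpace_coe
  have : Nontrivial M := Submodule.nontrivial_iff_ne_bot.2 hMbot
  by_cases hMfin : FiniteDimensional ℂ M
  · exact isMinimumAttaining_of_finiteDimensional _
  by_cases hmb : minimumModulus (T ∘L M.subtypeL) = b
  · have : FiniteDimensional ℂ (H ⧸ discSpectralSubspace T 0 b) :=
      finiteDimensional_quotient_discSpectralSubspace
        (by simpa only [sub_zero] using fun z hz => (hess z hz).le) (by simpa only [sub_zero])
    obtain ⟨x, hxM, hx0, hx⟩ :=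
      exists_mem_ne_zero_map_eq_zero hMfin (discSpectralSubspace T 0 b).mkQ
    have hTx : ‖T x - (0 : ℂ) • x‖ ≤ b * ‖x‖ := norm_sub_smul_le_of_mem_discSpectralSubspace hb
      ((Submodule.Quotient.mk_eq_zero _).1 hx)
    rw [zero_smul, sub_zero, ← hmb] at hTx
    exact isMinimumAttaining_of_norm_apply_le (x := ⟨x, hxM⟩) (by simpa using hx0) hTx
  · have hsq : b ^ 2 ≠ minimumModulus (T ∘L M.subtypeL) ^ 2 := fun h =>
      hmb ((pow_left_inj₀ hb (minimumModulus_nonneg _) two_ne_zero).1 h).symm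
    exact isMinimumAttaining_of_isCompactOperator _ hsq
      (isCompactOperator_restrict_adjoint_comp_self_sub hess M)

end Spectrum

section IsPositive

variable {H : Type*} [NormedAddCommGroup H] [InnerProductSpace ℂ H] [CompleteSpace H]
  {T : H →L[ℂ] H}

theorem eq_norm_of_mem_spectrum_of_isPositive (hT : T.IsPositive) {z : ℂ}
    (hz : z ∈ spectrum ℂ T) : z = ‖z‖ :=
  Complex.eq_coe_norm_of_nonneg
    (spectrum_nonneg_of_nonneg ((ContinuousLinearMap.nonneg_iff_isPositive T).2 hT) hz)

theorem image_ofReal_norm_eq_of_isPositive (hT : T.IsPositive) {s : Set ℂ}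
    (hs : s ⊆ spectrum ℂ T) : Complex.ofReal '' ((fun z : ℂ => ‖z‖) '' s) = s := by
  rw [image_image]
  exact (image_congr fun z hz => (eq_norm_of_mem_spectrum_of_isPositive hT (hs hz)).symm).trans
    (image_id s)

theorem exists_image_norm_eq_singleton_iff_of_isPositive (hT : T.IsPositive) {s : Set ℂ}
    (hs : s ⊆ spectrum ℂ T) :
    (∃ b : ℝ, (fun z : ℂ => ‖z‖) '' s = {b}) ↔ ∃ b : ℂ, s = {b} := by
  constructor
  · rintro ⟨b, hb⟩
    exact ⟨b, by rw [← image_ofReal_norm_eq_of_isPositive hT hs, hb, image_singleton]⟩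
  · rintro ⟨b, rfl⟩
    exact ⟨‖b‖, image_singleton⟩

theorem finite_setOf_hasEigenvalue_iff_of_isPositive (hT : T.IsPositive) (c : ℝ) :
    {z : ℂ | c < ‖z‖ ∧ Module.End.HasEigenvalue (T : H →ₗ[ℂ] H) z}.Finite ↔
      {t : ℝ | t ∈ Ioc c ‖T‖ ∧ Module.End.HasEigenvalue (T : H →ₗ[ℂ] H) (t : ℂ)}.Finite := by
  have himage : {z : ℂ | c < ‖z‖ ∧ Module.End.HasEigenvalue (T : H →ₗ[ℂ] H) z} = Complex.ofReal ''
      {t : ℝ | t ∈ Ioc c ‖T‖ ∧ Module.End.HasEigenvalue (T : H →ₗ[ℂ] H) (t : ℂ)} := by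
    ext z
    constructor
    · rintro ⟨hcz, hz⟩
      have hzT := mem_spectrum_of_hasEigenvalue hz
      have hz_eq := eq_norm_of_mem_spectrum_of_isPositive hT hzT
      have : Nontrivial H := hz.exists_hasEigenvector.elim fun x hx => nontrivial_of_ne x 0 hx.2
      exact ⟨‖z‖, ⟨⟨hcz, spectrum.norm_le_norm_of_mem hzT⟩, hz_eq ▸ hz⟩, hz_eq.symm⟩
    · rintro ⟨t, ⟨ht, heig⟩, rfl⟩
      exact ⟨ht.1.trans_le (by simpa using le_abs_self t), heig⟩
  rw [himage, finite_image_iff Complex.ofReal_injective.injOn]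

end IsPositive

theorem theorem3p9_general {H : Type*} [NormedAddCommGroup H] [InnerProductSpace ℂ H]
    [CompleteSpace H] (hH : ¬ FiniteDimensional ℂ H) (T : H →L[ℂ] H) [IsStarNormal T] :
    IsAbsolutelyMinimumAttaining T ↔
      (∃ b : ℝ, (fun z : ℂ => ‖z‖) '' essentialSpectrum T = {b}) ∧
      {z : ℂ | essentialMinimumModulus T < ‖z‖ ∧
        Module.End.HasEigenvalue (T : H →ₗ[ℂ] H) z}.Finite := by
  have hmin {b : ℝ} (hb : (fun z : ℂ => ‖z‖) '' essentialSpectrum T = {b}) :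
      essentialMinimumModulus T = b := by
    rw [essentialMinimumModulus, hb, csInf_singleton]
  obtain ⟨a, ha⟩ := essentialSpectrum_nonempty hH T
  constructor
  · intro hT
    have hnorm : (fun z : ℂ => ‖z‖) '' essentialSpectrum T = {‖a‖} :=
      eq_singleton_iff_unique_mem.2 ⟨⟨a, ha, rfl⟩, forall_mem_image.2 fun z hz => le_antisymm
        (hT.norm_le_of_mem_essentialSpectrum ha hz) (hT.norm_le_of_mem_essentialSpectrum hz ha)⟩
    refine ⟨⟨_, hnorm⟩, ?_⟩
    rw [hmin hnorm]
    exact hT.finite_setOf_hasEigenvalue fun z hz => hT.norm_le_of_mem_essentialSpectrum ha hz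
  · rintro ⟨⟨b, hb⟩, hfin⟩
    rw [hmin hb] at hfin
    have hess (z : ℂ) (hz : z ∈ essentialSpectrum T) : ‖z‖ = b := hb.subset ⟨z, hz, rfl⟩
    exact isAbsolutelyMinimumAttaining_of_norm_eq_of_mem_essentialSpectrum
      (hess a ha ▸ norm_nonneg a) hess hfin

theorem theorem3p9 {H : Type*} [NormedAddCommGroup H] [InnerProductSpace ℂ H] [CompleteSpace H]
    (hH : ¬ FiniteDimensional ℂ H) (T : H →L[ℂ] H) (hT : T.IsPositive) :
    IsAbsolutelyMinimumAttaining T ↔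
      (∃ b : ℂ, essentialSpectrum T = {b}) ∧
      {t : ℝ | t ∈ Set.Ioc (essentialMinimumModulus T) ‖T‖ ∧
        Module.End.HasEigenvalue (T : H →ₗ[ℂ] H) (t : ℂ)}.Finite := by
  have : IsStarNormal T := hT.isSelfAdjoint.isStarNormal
  rw [theorem3p9_general hH T,
    exists_image_norm_eq_singleton_iff_of_isPositive (s := essentialSpectrum T) hT sdiff_subset,
    finite_setOf_hasEigenvalue_iff_of_isPositive hT]
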